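/- **Canonicity of stable independence relations.** An *AECat* is a pair $(\mathcal C,\mathcal M)$ where $\mathcal C$ is an accessible category and $\mathcal M$ is a full subcategory of $\mathcal C$ (its objects are called *models*) that is itself accessible, such that $\mathcal M$ has directed colimits, the inclusion $\mathcal M\hookrightarrow\mathcal C$ preserves them, and every arrow of $\mathcal C$ is a monomorphism. It has the *amalgamation property* if for all arrows $N_1\leftarrow M\to N_2$ between models there are a model $U$ and arrows $N_1\to U\leftarrow N_2$ that make the square commute. An *extension* of a model $M$ is an arrow $M\to N$ with $N$ a model; arrows into $M$ and subobjects of $M$ are regarded as arrows into and subobjects of $N$ by composing with it. For arrows $a_i:A_i\to M$ and $a_i':A_i\to M'$ into models, $\operatorname{gtp}((a_i)_i;M)=\operatorname{gtp}((a'_i)_i;M')$ means that there are extensions $M\to N\leftarrow M'$ such that $a_i$ and $a_i'$ become equal as arrows into $N$ for all $i$; for tuples of subobjects $A_i\le M$, $A_i'\le M'$, equality of Galois types means that for some extensions $M\to N\leftarrow M'$ one has $A_i=A_i'$ as subobjects of $N$ for all $i$. An *independence relation* is a relation on triples of subobjects of models, written $A\perp^M_C B$ for $A,B,C\le M$. For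 arrows $a,b,\dots$ we write $A,B,\dots$ for the subobjects they represent. Consider the following properties; all cardinals $\lambda,\Upsilon(\lambda)$ are infinite and regular. - *Invariance*: if $A\perp^M_C B$ and $\operatorname{gtp}(A,B,C;M)=\operatorname{gtp}(A',B',C';M')$, then $A'\perp^{M'}_{C'}B'$. - *Monotonicity*: if $A\perp^M_C B$ and $B'\le B$, then $A\perp^M_C B'$. - *Base-monotonicity*: if $A\perp^M_C B$ and $C\le C'\le B$, then $A\perp^M_{C'}B$. - *Transitivity*: if $A\perp^M_B C$, $A\perp^M_C D$ and $B\le C$, then there are an extension $M\to N$ and $E\le N$ with $A\perp^N_B E$ and $C,D\le E$. - *Symmetry*: if $A\perp^M_C B$, then $B\perp^M_C A$. - *Existence*: for all arrows $a:A\to M$, $c:C\to M$ and all $B\le M$ there are an extension $M\to M'$ and an arrow $a':A\to M'$ with $A'\perp^{M'}_C B$ and $\operatorname{gtp}(a',c;M')=\operatorname{gtp}(a,c;M)$. - *Union*: if $(B_i)_{i\in I}$ is a directed system in $\mathcal C$ with a cocone into a model $M$, $B=\operatorname{colim}_i B_i$ exists in $\mathcal C$, and $A\perp^M_C B_i$ for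 all $i$, then $A\perp^M_C B$. - *Local character*: for every $\lambda$ there is $\Upsilon(\lambda)$ such that for all subobjects $A,B$ of a model $M$ with $A$ $\lambda$-presentable there is a $\Upsilon(\lambda)$-presentable $B'\le B$ with $A\perp^M_{B'}B$. - *Stationarity*: for all objects $A,B$, every model $M$, arrows $a,b,m$ from $A,B,M$ to a model $N$ and arrows $a',b',m'$ from $A,B,M$ to a model $N'$: if $\operatorname{gtp}(a,m;N)=\operatorname{gtp}(a',m';N')$, $\operatorname{gtp}(b,m;N)=\operatorname{gtp}(b',m';N')$, $A\perp^N_M B$ and $A'\perp^{N'}_{M'}B'$ (where $A',B',M'$ are the subobjects of $N'$ represented by $a',b',m'$), then $\operatorname{gtp}(a,b,m;N)=\operatorname{gtp}(a',b',m';N')$. - *3-amalgamation*: let $M$ be a model, let $A,B,C$ be objects, and let $a_1,b_1,m_1$ from $A,B,M$ to $N_1$, $b_2,c_2,m_2$ from $B,C,M$ to $N_2$, and $c_3,a_3,m_3$ from $C,A,M$ to $N_3$ be arrows into models. Suppose that, for the represented subobjects, $A\perp^{N_1}_M B$, $B\perp^{N_2}_M C$, $C\perp^{N_3}_M A$, and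 that $\operatorname{gtp}(a_1,m_1;N_1)=\operatorname{gtp}(a_3,m_3;N_3)$, $\operatorname{gtp}(b_1,m_1;N_1)=\operatorname{gtp}(b_2,m_2;N_2)$, $\operatorname{gtp}(c_2,m_2;N_2)=\operatorname{gtp}(c_3,m_3;N_3)$. Then there are a model $N$ and extensions $N_1,N_2,N_3\to N$ such that the two resulting arrows $A\to N$ agree, and likewise those from $B$ and from $C$ and the three from $M$, and such that $A\perp^N_M N_2$. An independence relation that satisfies all of invariance, monotonicity, base-monotonicity, transitivity, symmetry, existence, union and local character is called *stable* if it also satisfies stationarity, and *simple* if it also satisfies 3-amalgamation. **Statement.** Let $(\mathcal C,\mathcal M)$ be an AECat with the amalgamation property. Then any two stable independence relations on it are equal. Moreover, if $\perp$ is a stable independence relation and $\perp'$ is a simple independence relation on $(\mathcal C,\mathcal M)$, then $\perp=\perp'$, that is, $A\perp^M_C B$ if and only if $A\perp'^{\,M}_C B$ for every model $M$ and all subobjects $A,B,C$ of $M$. -/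

import Mathlib

open CategoryTheory CategoryTheory.Limits

universe w v u

/-- An AECat `(C, M)`: both `C` and its full subcategory `M` of models are accessible, `M` has
(small) directed colimits which the inclusion into `C` preserves, and all arrows of `C` are
monomorphisms. The universe `w` is the universe of small sets. -/
structure AECat (C : Type u) [Category.{v} C] where
  /-- The objects of the full subcategory of models. -/
  isModel : ObjectProperty C
  accessible : IsAccessibleCategory.{w} C
  accessible_models : IsAccessibleCategory.{w} isModel.FullSubcategory
  hasDirectedColimits : ∀ (J : Type w) [PartialOrder J] [IsDirected J (· ≤ ·)] [Nonempty J],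
    HasColimitsOfShape J isModel.FullSubcategory
  preservesDirectedColimits : ∀ (J : Type w) [PartialOrder J] [IsDirected J (· ≤ ·)] [Nonempty J],
    PreservesColimitsOfShape J isModel.ι
  mono : ∀ {X Y : C} (f : X ⟶ Y), Mono f

namespace AECat

variable {C : Type u} [Category.{v} C] (𝒜 : AECat.{w} C)

/-- The models. As models form a full subcategory, an extension of models `M → N` is
an arbitrary arrow `M.obj ⟶ N.obj` of `C`. -/
abbrev Model := 𝒜.isModel.FullSubcategory

/-- The amalgamation property (for the category of models). -/
def HasAP : Prop :=
  ∀ (M N₁ N₂ : 𝒜.Model) (f₁ : M.obj ⟶ N₁.obj) (f₂ : M.obj ⟶ N₂.obj),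
    ∃ (U : 𝒜.Model) (g₁ : N₁.obj ⟶ U.obj) (g₂ : N₂.obj ⟶ U.obj), f₁ ≫ g₁ = f₂ ≫ g₂

/-- The subobject represented by an arrow. -/
def sub {X Y : C} (f : X ⟶ Y) : Subobject Y :=
  haveI := 𝒜.mono f
  Subobject.mk f

/-- A subobject of `X`, viewed as a subobject of `Y` along an arrow `f : X ⟶ Y`. -/
def push {X Y : C} (f : X ⟶ Y) (A : Subobject X) : Subobject Y :=
  haveI := 𝒜.mono f
  (Subobject.map f).obj A

/-- Equality of Galois types of pairs of arrows, `gtp(a, b; M) = gtp(a', b'; M')`. -/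
def GtpEq₂ {A B : C} {M M' : 𝒜.Model} (a : A ⟶ M.obj) (b : B ⟶ M.obj)
    (a' : A ⟶ M'.obj) (b' : B ⟶ M'.obj) : Prop :=
  ∃ (N : 𝒜.Model) (f : M.obj ⟶ N.obj) (g : M'.obj ⟶ N.obj),
    a ≫ f = a' ≫ g ∧ b ≫ f = b' ≫ g

/-- Equality of Galois types of triples of arrows, `gtp(a, b, c; M) = gtp(a', b', c'; M')`. -/
def GtpEq₃ {A B D : C} {M M' : 𝒜.Model} (a : A ⟶ M.obj) (b : B ⟶ M.obj) (c : D ⟶ M.obj)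
    (a' : A ⟶ M'.obj) (b' : B ⟶ M'.obj) (c' : D ⟶ M'.obj) : Prop :=
  ∃ (N : 𝒜.Model) (f : M.obj ⟶ N.obj) (g : M'.obj ⟶ N.obj),
    a ≫ f = a' ≫ g ∧ b ≫ f = b' ≫ g ∧ c ≫ f = c' ≫ g

/-- Equality of Galois types of triples of subobjects. -/
def SubGtpEq₃ {M M' : 𝒜.Model} (A B D : Subobject M.obj) (A' B' D' : Subobject M'.obj) : Prop :=
  ∃ (N : 𝒜.Model) (f : M.obj ⟶ N.obj) (g : M'.obj ⟶ N.obj),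
    𝒜.push f A = 𝒜.push g A' ∧ 𝒜.push f B = 𝒜.push g B' ∧ 𝒜.push f D = 𝒜.push g D'

/-- An independence relation: a relation on triples of subobjects of models.
`r M A B D` reads "`A` is independent from `B` over `D` in `M`": the base is the last argument. -/
abbrev IndepRel :=
  ∀ M : 𝒜.Model, Subobject M.obj → Subobject M.obj → Subobject M.obj → Prop

namespace IndepRel

variable {𝒜} (r : 𝒜.IndepRel)

def Invariance : Prop :=
  ∀ (M M' : 𝒜.Model) (A B D : Subobject M.obj) (A' B' D' : Subobject M'.obj),
    r M A B D → 𝒜.SubGtpEq₃ A B D A' B' D' → r M' A' B' D'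

def Monotonicity : Prop :=
  ∀ (M : 𝒜.Model) (A B D B' : Subobject M.obj), r M A B D → B' ≤ B → r M A B' D

def BaseMonotonicity : Prop :=
  ∀ (M : 𝒜.Model) (A B D D' : Subobject M.obj),
    r M A B D → D ≤ D' → D' ≤ B → r M A B D'

def Transitivity : Prop :=
  ∀ (M : 𝒜.Model) (A B D F : Subobject M.obj), r M A D B → r M A F D → B ≤ D →
    ∃ (N : 𝒜.Model) (f : M.obj ⟶ N.obj) (E : Subobject N.obj),
      r N (𝒜.push f A) E (𝒜.push f B) ∧ 𝒜.push f D ≤ E ∧ 𝒜.push f F ≤ E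

def Symmetry : Prop :=
  ∀ (M : 𝒜.Model) (A B D : Subobject M.obj), r M A B D → r M B A D

def Existence : Prop :=
  ∀ (M : 𝒜.Model) (A D : C) (a : A ⟶ M.obj) (c : D ⟶ M.obj) (B : Subobject M.obj),
    ∃ (M' : 𝒜.Model) (f : M.obj ⟶ M'.obj) (a' : A ⟶ M'.obj),
      r M' (𝒜.sub a') (𝒜.push f B) (𝒜.sub (c ≫ f)) ∧ 𝒜.GtpEq₂ a' (c ≫ f) a c

/-- `F` is a directed system in `C` with a colimit cocone `t`, and `β` is a cocone on `F` with
vertex the model `M`; the colimit is a subobject of `M` via the induced arrow. -/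
def Union : Prop :=
  ∀ (J : Type w) [PartialOrder J] [IsDirected J (· ≤ ·)] [Nonempty J]
    (F : J ⥤ C) (M : 𝒜.Model) (β : F ⟶ (Functor.const J).obj M.obj)
    (t : Cocone F) (ht : IsColimit t) (A D : Subobject M.obj),
    (∀ j : J, r M A (𝒜.sub (β.app j : F.obj j ⟶ M.obj)) D) →
      r M A (𝒜.sub (ht.desc (Cocone.mk M.obj β) : t.pt ⟶ M.obj)) D

def Stationarity : Prop :=
  ∀ (A B : C) (M N N' : 𝒜.Model)
    (a : A ⟶ N.obj) (b : B ⟶ N.obj) (m : M.obj ⟶ N.obj)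
    (a' : A ⟶ N'.obj) (b' : B ⟶ N'.obj) (m' : M.obj ⟶ N'.obj),
    𝒜.GtpEq₂ a m a' m' → 𝒜.GtpEq₂ b m b' m' →
    r N (𝒜.sub a) (𝒜.sub b) (𝒜.sub m) → r N' (𝒜.sub a') (𝒜.sub b') (𝒜.sub m') →
    𝒜.GtpEq₃ a b m a' b' m'

/-- For every regular `κ` there is a regular `υ` (the value at `κ` of a local character function)
such that every `κ`-presentable `A ≤ M` is independent from every `B ≤ M` over some
`υ`-presentable `B' ≤ B`. -/
def LocalCharacter : Prop :=
  ∀ (κ : Cardinal.{w}) [Fact κ.IsRegular], ∃ (υ : Cardinal.{w}) (_ : Fact υ.IsRegular),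
    ∀ (M : 𝒜.Model) (A B : Subobject M.obj), IsCardinalPresentable (A : C) κ →
      ∃ B' : Subobject M.obj, B' ≤ B ∧ IsCardinalPresentable (B' : C) υ ∧ r M A B B'

def ThreeAmalgamation : Prop :=
  ∀ (A B D : C) (M N₁ N₂ N₃ : 𝒜.Model)
    (a₁ : A ⟶ N₁.obj) (b₁ : B ⟶ N₁.obj) (m₁ : M.obj ⟶ N₁.obj)
    (b₂ : B ⟶ N₂.obj) (c₂ : D ⟶ N₂.obj) (m₂ : M.obj ⟶ N₂.obj)
    (c₃ : D ⟶ N₃.obj) (a₃ : A ⟶ N₃.obj) (m₃ : M.obj ⟶ N₃.obj),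
    r N₁ (𝒜.sub a₁) (𝒜.sub b₁) (𝒜.sub m₁) →
    r N₂ (𝒜.sub b₂) (𝒜.sub c₂) (𝒜.sub m₂) →
    r N₃ (𝒜.sub c₃) (𝒜.sub a₃) (𝒜.sub m₃) →
    𝒜.GtpEq₂ a₁ m₁ a₃ m₃ → 𝒜.GtpEq₂ b₁ m₁ b₂ m₂ → 𝒜.GtpEq₂ c₂ m₂ c₃ m₃ →
    ∃ (N : 𝒜.Model) (f₁ : N₁.obj ⟶ N.obj) (f₂ : N₂.obj ⟶ N.obj) (f₃ : N₃.obj ⟶ N.obj),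
      a₁ ≫ f₁ = a₃ ≫ f₃ ∧ b₁ ≫ f₁ = b₂ ≫ f₂ ∧ c₂ ≫ f₂ = c₃ ≫ f₃ ∧
      m₁ ≫ f₁ = m₂ ≫ f₂ ∧ m₂ ≫ f₂ = m₃ ≫ f₃ ∧
      r N (𝒜.sub (a₁ ≫ f₁)) (𝒜.sub f₂) (𝒜.sub (m₁ ≫ f₁))

/-- The properties that simple and stable independence relations share. -/
structure IsBasic : Prop where
  invariance : r.Invariance
  monotonicity : r.Monotonicity
  baseMonotonicity : r.BaseMonotonicity
  transitivity : r.Transitivity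
  symmetry : r.Symmetry
  existence : r.Existence
  union : r.Union
  localCharacter : r.LocalCharacter

/-- A stable independence relation. -/
structure IsStable : Prop extends r.IsBasic where
  stationarity : r.Stationarity

/-- A simple independence relation. -/
structure IsSimple : Prop extends r.IsBasic where
  threeAmalgamation : r.ThreeAmalgamation

end IndepRel

end AECat

/-! The relations are compared first over models, then over arbitrary bases. Let `r` be stable, `r'`
satisfy the shared axioms, and `A` be `r`-independent from `B` over a model `M`. A long
`r'`-independent chain of copies of `B` over `M` has, by local character, a member `r'`-independent
from any given copy of `A` (`exists_long_sequence`). Choose that copy `r`-independent from the whole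
chain: stationarity gives it and the member the type of `(A, B)` over `M`, so `r'` transfers to `A`
and `B`.

For simple `r'`, the converse has no stationarity to use. Instead the copies of `B` are chosen
`r`-independent, and 3-amalgamation for `r'` keeps one copy of `A` in its given type with each of
them; local character of `r` then picks out a copy that is `r`-independent from it
(`IsSimple.leOverModels`).

For a general base `D`, `le_of_leOverModels` finds a model above `D` independent from `A` over `D`
in both senses, applies the comparison over it, and descends to `D` by transitivity. -/

/-! ### Transfinite chains with an invariant -/

namespace CategoryTheory.SmallObject

/-- A transfinite construction: a property `good` of objects that is preserved by suitable
successor steps and by colimits of chains of limit length holds along a chain of such steps. -/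
theorem exists_functor_of_succ_of_colimit {D : Type u} [Category.{v} D] (J : Type w)
    [LinearOrder J] [OrderBot J] [SuccOrder J] [WellFoundedLT J] [NoMaxOrder J]
    [HasIterationOfShape J D] (good : ObjectProperty D) (R : MorphismProperty D)
    (X₀ : D) (h₀ : good X₀)
    (hsucc : ∀ X, good X → ∃ (Y : D) (f : X ⟶ Y), R f ∧ good Y)
    (hlim : ∀ (j : J), Order.IsSuccLimit j → ∀ (G : Set.Iio j ⥤ D) (c : Cocone G),
      IsColimit c → (∀ k, good (G.obj k)) → good c.pt) :
    ∃ F : J ⥤ D, (∀ j, good (F.obj j)) ∧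
      ∀ j, R (F.map (homOfLE (Order.le_succ j))) := by
  classical
  -- A `SuccStruct` needs a successor at every object, so objects that are not `good` get the
  -- identity.
  have hsucc' : ∀ X, ∃ (Y : D) (f : X ⟶ Y), good X → R f ∧ good Y := fun X => by
    by_cases hX : good X
    · obtain ⟨Y, f, h⟩ := hsucc X hX
      exact ⟨Y, f, fun _ => h⟩
    · exact ⟨X, 𝟙 X, fun h => (hX h).elim⟩
  choose S t ht using hsucc'
  let Φ : SuccStruct D := { X₀ := X₀, succ := S, toSucc := t }
  have hΦ : ∀ {X Y : D} (f : X ⟶ Y), Φ.prop f → good X → R f ∧ good Y := by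
    rintro _ _ _ ⟨_⟩ hX
    exact ht _ hX
  have hgood : ∀ j, good ((Φ.iterationFunctor J).obj j) := fun j => by
    induction j using SuccOrder.limitRecOn with
    | isMin j hj =>
      obtain rfl := hj.eq_bot
      have : (Φ.iterationFunctor J).obj ⊥ = X₀ := (Φ.iter ⊥).obj_bot
      rwa [this]
    | succ j hj ih => exact (hΦ _ (Φ.prop_iterationFunctor_map_succ j hj) ih).2
    | isSuccLimit j hj ih =>
      exact hlim j hj _ _ ((Φ.iterationFunctor J).isColimitOfIsWellOrderContinuous j hj)
        fun k => ih k.1 k.2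
  exact ⟨Φ.iterationFunctor J, hgood, fun j =>
    (hΦ _ (Φ.prop_iterationFunctor_map_succ j (not_isMax j)) (hgood j)).1⟩

end CategoryTheory.SmallObject

/-- Colimits of connected shape in `Under X` are computed in `D`, and nonempty linear orders are
connected. -/
theorem CategoryTheory.Limits.hasIterationOfShape_under {D : Type u} [Category.{v} D] (J : Type w)
    [LinearOrder J] [OrderBot J] [HasIterationOfShape J D] (X : D) :
    HasIterationOfShape J (Under X) where
  hasColimitsOfShape_of_isSuccLimit j hj := by
    have := hasColimitsOfShape_of_isSuccLimit D j hj
    have : Nonempty (Set.Iio j) := ⟨⟨⊥, hj.bot_lt⟩⟩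
    have := IsFiltered.isConnected (Set.Iio j)
    infer_instance
  hasColimitsOfShape := by
    have := IsFiltered.isConnected J
    infer_instance

/-- A version of `exists_functor_of_succ_of_colimit` for chains of objects under `X₀`. -/
theorem CategoryTheory.SmallObject.exists_functor_under_of_succ_of_colimit {D : Type u}
    [Category.{v} D] (J : Type w) [LinearOrder J] [OrderBot J] [SuccOrder J] [WellFoundedLT J]
    [NoMaxOrder J] [HasIterationOfShape J D] (X₀ : D) (good : ∀ {Y : D}, (X₀ ⟶ Y) → Prop)
    (R : ∀ {Y Z : D}, (X₀ ⟶ Y) → (Y ⟶ Z) → Prop) (h₀ : good (𝟙 X₀))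
    (hsucc : ∀ (Y : D) (y : X₀ ⟶ Y), good y → ∃ (Z : D) (f : Y ⟶ Z), R y f ∧ good (y ≫ f))
    (hlim : ∀ (j : J), Order.IsSuccLimit j → ∀ (G : Set.Iio j ⥤ D) (c : Cocone G),
      IsColimit c → ∀ (y : ∀ k, X₀ ⟶ G.obj k) (x : X₀ ⟶ c.pt), (∀ k, y k ≫ c.ι.app k = x) →
        (∀ k, good (y k)) → good x) :
    ∃ (P : J ⥤ D) (x : ∀ j, X₀ ⟶ P.obj j), (∀ j k (h : j ⟶ k), x j ≫ P.map h = x k) ∧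
      (∀ j, good (x j)) ∧ ∀ j, R (x j) (P.map (homOfLE (Order.le_succ j))) := by
  have := hasIterationOfShape_under J X₀
  let R' : MorphismProperty (Under X₀) := fun Y _ f => R Y.hom f.right
  obtain ⟨F, hF, hF'⟩ := exists_functor_of_succ_of_colimit J (D := Under X₀)
    (fun Y => good Y.hom) R' (Under.mk (𝟙 X₀)) h₀
    (fun Y hY => by
      obtain ⟨Z, f, h₁, h₂⟩ := hsucc _ Y.hom hY
      exact ⟨Under.mk (Y.hom ≫ f), Under.homMk f, h₁, h₂⟩)
    (fun j hj G c hc hG => by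
      have : Nonempty (Set.Iio j) := ⟨⟨⊥, hj.bot_lt⟩⟩
      have := IsFiltered.isConnected (Set.Iio j)
      exact hlim j hj _ _ (isColimitOfPreserves (Under.forget X₀) hc) (fun k => (G.obj k).hom)
        c.pt.hom (fun k => Under.w (c.ι.app k)) hG)
  exact ⟨F ⋙ Under.forget X₀, fun j => (F.obj j).hom, fun j k h => Under.w (F.map h), hF, hF'⟩

/-! ### Subobjects and Galois types -/

namespace AECat

variable {C : Type u} [Category.{v} C] (𝒜 : AECat.{w} C)

section Subobject

variable {X Y Z : C}

lemma push_sub (a : X ⟶ Y) (f : Y ⟶ Z) : 𝒜.push f (𝒜.sub a) = 𝒜.sub (a ≫ f) :=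
  haveI := 𝒜.mono a
  haveI := 𝒜.mono f
  Subobject.map_mk a f

lemma sub_arrow (A : Subobject X) : 𝒜.sub A.arrow = A := Subobject.mk_arrow A

lemma push_eq_sub (f : X ⟶ Y) (A : Subobject X) : 𝒜.push f A = 𝒜.sub (A.arrow ≫ f) := by
  rw [← push_sub, sub_arrow]

lemma push_top (f : X ⟶ Y) : 𝒜.push f ⊤ = 𝒜.sub f :=
  haveI := 𝒜.mono f
  Subobject.map_top f

lemma push_id (A : Subobject X) : 𝒜.push (𝟙 X) A = A := Subobject.map_id A

lemma push_mono (f : X ⟶ Y) {A B : Subobject X} (h : A ≤ B) : 𝒜.push f A ≤ 𝒜.push f B :=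
  haveI := 𝒜.mono f
  (Subobject.map f).monotone h

lemma sub_comp_le (a : X ⟶ Y) (f : Y ⟶ Z) : 𝒜.sub (a ≫ f) ≤ 𝒜.sub f := by
  have := 𝒜.mono f
  have := 𝒜.mono (a ≫ f)
  exact Subobject.mk_le_mk_of_comm a rfl

lemma sub_le_of_comp_eq {a : X ⟶ Z} {f : Y ⟶ Z} (k : X ⟶ Y) (h : k ≫ f = a) :
    𝒜.sub a ≤ 𝒜.sub f := h ▸ 𝒜.sub_comp_le k f

lemma push_le_sub (f : X ⟶ Y) (A : Subobject X) : 𝒜.push f A ≤ 𝒜.sub f := by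
  rw [push_eq_sub]
  exact 𝒜.sub_comp_le _ _

lemma isCardinalPresentable_sub (a : X ⟶ Y) (κ : Cardinal.{w}) [Fact κ.IsRegular]
    [IsCardinalPresentable X κ] : IsCardinalPresentable (𝒜.sub a : C) κ :=
  haveI := 𝒜.mono a
  isCardinalPresentable_of_iso (Subobject.underlyingIso a).symm κ

end Subobject

lemma exists_isCardinalPresentable (𝒜 : AECat.{w} C) (X : C) :
    ∃ (κ : Cardinal.{w}) (_ : Fact κ.IsRegular), IsCardinalPresentable X κ := by
  have := 𝒜.accessible
  obtain ⟨κ, hκ, h⟩ := (inferInstance : IsPresentable.{w} X).exists_cardinal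
  exact ⟨κ, hκ, h⟩

lemma hasIterationOfShape_model (J : Type w) [LinearOrder J] [OrderBot J] :
    HasIterationOfShape J 𝒜.Model where
  hasColimitsOfShape_of_isSuccLimit j hj :=
    haveI : Nonempty (Set.Iio j) := ⟨⟨⊥, hj.bot_lt⟩⟩
    𝒜.hasDirectedColimits (Set.Iio j)
  hasColimitsOfShape := 𝒜.hasDirectedColimits J

lemma GtpEq₂.symm {𝒜 : AECat.{w} C} {A B : C} {M M' : 𝒜.Model} {a : A ⟶ M.obj} {b : B ⟶ M.obj}
    {a' : A ⟶ M'.obj} {b' : B ⟶ M'.obj} (h : 𝒜.GtpEq₂ a b a' b') : 𝒜.GtpEq₂ a' b' a b := by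
  obtain ⟨N, f, g, h₁, h₂⟩ := h
  exact ⟨N, g, f, h₁.symm, h₂.symm⟩

/-- Types do not change in an extension. -/
lemma GtpEq₂.of_comp_left {𝒜 : AECat.{w} C} {A B : C} {M M' N : 𝒜.Model} {a : A ⟶ M.obj}
    {b : B ⟶ M.obj} {f : M.obj ⟶ N.obj} {a' : A ⟶ M'.obj} {b' : B ⟶ M'.obj}
    (h : 𝒜.GtpEq₂ (a ≫ f) (b ≫ f) a' b') : 𝒜.GtpEq₂ a b a' b' := by
  obtain ⟨U, g, k, h₁, h₂⟩ := h
  exact ⟨U, f ≫ g, k, by simpa using h₁, by simpa using h₂⟩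

lemma GtpEq₂.of_comp_right {𝒜 : AECat.{w} C} {A B : C} {M M' N : 𝒜.Model} {a : A ⟶ M.obj}
    {b : B ⟶ M.obj} {f : M'.obj ⟶ N.obj} {a' : A ⟶ M'.obj} {b' : B ⟶ M'.obj}
    (h : 𝒜.GtpEq₂ a b (a' ≫ f) (b' ≫ f)) : 𝒜.GtpEq₂ a b a' b' :=
  h.symm.of_comp_left.symm

lemma GtpEq₂.trans {𝒜 : AECat.{w} C} (hAP : 𝒜.HasAP) {A B : C} {M M' M'' : 𝒜.Model}
    {a : A ⟶ M.obj} {b : B ⟶ M.obj} {a' : A ⟶ M'.obj} {b' : B ⟶ M'.obj} {a'' : A ⟶ M''.obj}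
    {b'' : B ⟶ M''.obj} (h : 𝒜.GtpEq₂ a b a' b') (h' : 𝒜.GtpEq₂ a' b' a'' b'') :
    𝒜.GtpEq₂ a b a'' b'' := by
  obtain ⟨N, f, g, h₁, h₂⟩ := h
  obtain ⟨N', f', g', h₁', h₂'⟩ := h'
  obtain ⟨U, k, k', hk⟩ := hAP M' N N' g f'
  exact ⟨U, f ≫ k, g' ≫ k', by rw [reassoc_of% h₁, hk, reassoc_of% h₁'],
    by rw [reassoc_of% h₂, hk, reassoc_of% h₂']⟩

lemma GtpEq₂.comp_left {𝒜 : AECat.{w} C} (hAP : 𝒜.HasAP) {A B : C} {M M' N : 𝒜.Model}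
    {a : A ⟶ M.obj} {b : B ⟶ M.obj} {a' : A ⟶ M'.obj} {b' : B ⟶ M'.obj}
    (h : 𝒜.GtpEq₂ a b a' b') (f : M.obj ⟶ N.obj) : 𝒜.GtpEq₂ (a ≫ f) (b ≫ f) a' b' :=
  GtpEq₂.trans hAP ⟨N, 𝟙 _, f, by simp, by simp⟩ h

/-! ### Consequences of the shared axioms -/

namespace IndepRel

variable {𝒜} {r : 𝒜.IndepRel}

lemma Invariance.push_iff (hr : r.Invariance) {M N : 𝒜.Model} (f : M.obj ⟶ N.obj)
    {A B D : Subobject M.obj} :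
    r N (𝒜.push f A) (𝒜.push f B) (𝒜.push f D) ↔ r M A B D :=
  ⟨fun h => hr _ _ _ _ _ _ _ _ h ⟨N, 𝟙 _, f, by simp [push_id]⟩,
    fun h => hr _ _ _ _ _ _ _ _ h ⟨N, f, 𝟙 _, by simp [push_id]⟩⟩

lemma Invariance.comp_iff (hr : r.Invariance) {M N : 𝒜.Model} (f : M.obj ⟶ N.obj) {A B D : C}
    {a : A ⟶ M.obj} {b : B ⟶ M.obj} {c : D ⟶ M.obj} :
    r N (𝒜.sub (a ≫ f)) (𝒜.sub (b ≫ f)) (𝒜.sub (c ≫ f)) ↔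
      r M (𝒜.sub a) (𝒜.sub b) (𝒜.sub c) := by
  rw [← hr.push_iff f]
  simp only [push_sub]

lemma Invariance.of_gtpEq₃ (hr : r.Invariance) {M M' : 𝒜.Model} {A B D : C}
    {a : A ⟶ M.obj} {b : B ⟶ M.obj} {c : D ⟶ M.obj} {a' : A ⟶ M'.obj} {b' : B ⟶ M'.obj}
    {c' : D ⟶ M'.obj} (h : 𝒜.GtpEq₃ a b c a' b' c')
    (h' : r M (𝒜.sub a) (𝒜.sub b) (𝒜.sub c)) : r M' (𝒜.sub a') (𝒜.sub b') (𝒜.sub c') := by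
  obtain ⟨N, f, g, h₁, h₂, h₃⟩ := h
  exact hr _ _ _ _ _ _ _ _ h' ⟨N, f, g, by simp only [push_sub, h₁, h₂, h₃, and_self]⟩

namespace IsBasic

lemma mono (hr : r.IsBasic) {M : 𝒜.Model} {A A' B B' D : Subobject M.obj} (h : r M A B D)
    (hA : A' ≤ A) (hB : B' ≤ B) : r M A' B' D :=
  hr.symmetry _ _ _ _ (hr.monotonicity _ _ _ _ _
    (hr.symmetry _ _ _ _ (hr.monotonicity _ _ _ _ _ h hB)) hA)

/-- Every subobject is independent from the base. -/
lemma indep_base (hr : r.IsBasic) (M : 𝒜.Model) (A D : Subobject M.obj) : r M A D D := by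
  -- With `D` as both right side and base, the type given by existence already determines the whole
  -- triple.
  obtain ⟨M', f, a', h, U, g, k, h₁, h₂⟩ := hr.existence M _ _ A.arrow D.arrow D
  rw [push_eq_sub] at h
  have := hr.invariance.of_gtpEq₃ ⟨U, g, k, h₁, h₂, h₂⟩ h
  simpa only [sub_arrow] using this

/-- The right side of an independence can be enlarged to contain the base. -/
lemma exists_base_le (hr : r.IsBasic) {M : 𝒜.Model} {A B D : Subobject M.obj} (h : r M A B D) :
    ∃ (N : 𝒜.Model) (f : M.obj ⟶ N.obj) (E : Subobject N.obj),
      r N (𝒜.push f A) E (𝒜.push f D) ∧ 𝒜.push f D ≤ E ∧ 𝒜.push f B ≤ E :=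
  hr.transitivity M A D D B (hr.indep_base M A D) h le_rfl

/-- Transitivity followed by monotonicity, which needs no extension. -/
lemma trans (hr : r.IsBasic) {M : 𝒜.Model} {A B D F : Subobject M.obj} (h : r M A D B)
    (h' : r M A F D) (hB : B ≤ D) : r M A F B := by
  obtain ⟨N, f, E, hE, -, hF⟩ := hr.transitivity M A B D F h h' hB
  exact (hr.invariance.push_iff f).1 (hr.mono hE le_rfl hF)

/-- Local character along long chains of models. -/
theorem exists_indep_of_chain (hr : r.IsBasic) (A : C) :
    ∃ (υ : Cardinal.{w}) (_ : Fact υ.IsRegular),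
      ∀ (P : υ.ord.ToType ⥤ 𝒜.Model) (p : Cocone P) (_ : IsColimit p) (N : 𝒜.Model)
        (g : p.pt.obj ⟶ N.obj) (a : A ⟶ N.obj),
        ∃ j, r N (𝒜.sub a) (𝒜.sub g) (𝒜.sub ((p.ι.app j).hom ≫ g)) := by
  obtain ⟨κ, hκ, hA⟩ := 𝒜.exists_isCardinalPresentable A
  obtain ⟨υ, hυ, h⟩ := hr.localCharacter κ
  refine ⟨υ, hυ, fun P p hp N g a => ?_⟩
  obtain ⟨B', hB', hpres, hi⟩ := h N (𝒜.sub a) (𝒜.sub g) (𝒜.isCardinalPresentable_sub a κ)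
  have : Nonempty υ.ord.ToType := by simpa using Cardinal.IsRegular.ne_zero Fact.out
  have := 𝒜.preservesDirectedColimits υ.ord.ToType
  have := 𝒜.mono g
  let k : (B' : C) ⟶ p.pt.obj := Subobject.ofLEMk B' g hB'
  -- The chain has regular length `υ`, so the `υ`-presentable base factors through a stage, to which
  -- base-monotonicity enlarges it.
  obtain ⟨j, l, hl⟩ := IsCardinalPresentable.exists_hom_of_isColimit υ
    (isColimitOfPreserves 𝒜.isModel.ι hp) k
  refine ⟨j, hr.baseMonotonicity _ _ _ _ _ hi ?_ (𝒜.sub_comp_le _ _)⟩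
  rw [← 𝒜.sub_arrow B']
  refine 𝒜.sub_le_of_comp_eq l ?_
  have hl' : l ≫ (p.ι.app j).hom = k := hl
  rw [reassoc_of% hl']
  exact Subobject.ofLEMk_comp hB'

/-- Two independences over consecutive members of a chain of bases compose. -/
lemma indep_of_indep_stage (hr : r.IsBasic) {P Q N : 𝒜.Model} {A B D : C} {a : A ⟶ N.obj}
    {b : B ⟶ Q.obj} {d : D ⟶ P.obj} {f : P.obj ⟶ Q.obj} {g : Q.obj ⟶ N.obj}
    {S : Subobject N.obj}
    (h : r N (𝒜.sub a) S (𝒜.sub (f ≫ g))) (hS : 𝒜.sub g ≤ S)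
    (h' : r Q (𝒜.sub b) (𝒜.sub f) (𝒜.sub (d ≫ f))) :
    r N (𝒜.sub a) (𝒜.sub (b ≫ g)) (𝒜.sub (d ≫ f ≫ g)) := by
  have h₁ := (hr.invariance.comp_iff g).2 h'
  rw [Category.assoc] at h₁
  have h₂ := hr.symmetry _ _ _ _ (hr.mono h le_rfl ((𝒜.sub_comp_le b g).trans hS))
  exact hr.symmetry _ _ _ _ (hr.trans h₁ h₂ (𝒜.sub_comp_le _ _))

/-- There are independent sequences of realizations of a type that are so long that each
`A` is independent from one of their members. -/
theorem exists_long_sequence (hAP : 𝒜.HasAP) (hr : r.IsBasic) {M : 𝒜.Model} {B D : C} (b : B ⟶ M.obj)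
    (d : D ⟶ M.obj) (A : C) :
    ∃ (U : 𝒜.Model) (f : M.obj ⟶ U.obj) (ι : Type w) (β : ι → (B ⟶ U.obj)),
      (∀ i, 𝒜.GtpEq₂ (β i) (d ≫ f) b d) ∧
      ∀ (V : 𝒜.Model) (g : U.obj ⟶ V.obj) (a : A ⟶ V.obj),
        ∃ i, r V (𝒜.sub a) (𝒜.sub (β i ≫ g)) (𝒜.sub (d ≫ f ≫ g)) := by
  obtain ⟨υ, hυ, h⟩ := hr.exists_indep_of_chain A
  have : Nonempty υ.ord.ToType := by simpa using Cardinal.IsRegular.ne_zero Fact.out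
  let := WellFoundedLT.toOrderBot υ.ord.ToType
  have := Cardinal.noMaxOrder (c := υ) (Cardinal.IsRegular.aleph0_le Fact.out)
  let J := υ.ord.ToType
  have := 𝒜.hasIterationOfShape_model J
  obtain ⟨P, x, hx, -, hP⟩ := SmallObject.exists_functor_under_of_succ_of_colimit J M (D := 𝒜.Model)
    (fun _ => True) (fun {Y Z : 𝒜.Model} (y : M ⟶ Y) (f : Y ⟶ Z) => ∃ b' : B ⟶ Z.obj,
      r Z (𝒜.sub b') (𝒜.sub f.hom) (𝒜.sub (d ≫ y.hom ≫ f.hom)) ∧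
        𝒜.GtpEq₂ b' (d ≫ y.hom ≫ f.hom) b d) trivial
    (fun Y y _ => by
      -- The next copy of `B` is independent over `D` from the entire model built so far.
      obtain ⟨Z, f, b', h₁, h₂⟩ := hr.existence Y B D (b ≫ y.hom) (d ≫ y.hom) ⊤
      refine ⟨Z, ObjectProperty.homMk f, ⟨b', ?_, ?_⟩, trivial⟩
      · simpa [push_top] using h₁
      · simpa using h₂.of_comp_right)
    (fun _ _ _ _ _ _ _ _ _ => trivial)
  choose β hβ hβ' using hP
  let U := colimit P
  let s (j : J) : P.obj j ⟶ P.obj (Order.succ j) := P.map (homOfLE (Order.le_succ j))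
  let t (j : J) : P.obj j ⟶ U := colimit.ι P j
  have hs (j : J) : (s j).hom ≫ (t (Order.succ j)).hom = (t j).hom :=
    congrArg (·.hom) (colimit.w P (homOfLE (Order.le_succ j)))
  have ht (j : J) : (x j).hom ≫ (t j).hom = (x ⊥).hom ≫ (t ⊥).hom := by
    change (x j ≫ t j).hom = (x ⊥ ≫ t ⊥).hom
    rw [← hx ⊥ j (homOfLE bot_le), Category.assoc]
    congr 2
    exact colimit.w P _
  refine ⟨U, (x ⊥).hom ≫ (t ⊥).hom, J, fun j => β j ≫ (t (Order.succ j)).hom,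
    fun j => ?_, fun V g a => ?_⟩
  · rw [← ht j, ← hs j]
    simpa using GtpEq₂.comp_left hAP (hβ' j) (t (Order.succ j)).hom
  · obtain ⟨j, hj⟩ := h P (colimit.cocone P) (colimit.isColimit P) V g a
    refine ⟨j, ?_⟩
    change r V _ _ (𝒜.sub ((t j).hom ≫ g)) at hj
    rw [← hs j, Category.assoc] at hj
    have := hr.indep_of_indep_stage hj (𝒜.sub_comp_le _ _) (d := d ≫ (x j).hom)
      (by simpa using hβ j)
    rw [← ht j, ← hs j]
    simpa [s] using this

end IsBasic

/-! ### Comparison over models -/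

variable {r' : 𝒜.IndepRel}

/-- `r` implies `r'` whenever the base is a model. -/
def LEOverModels (r r' : 𝒜.IndepRel) : Prop :=
  ∀ (M N : 𝒜.Model) (A B : Subobject N.obj) (m : M.obj ⟶ N.obj),
    r N A B (𝒜.sub m) → r' N A B (𝒜.sub m)

/-- A stable independence relation implies any other one over models. -/
theorem IsStable.leOverModels (hAP : 𝒜.HasAP) (hr : r.IsStable) (hr' : r'.IsBasic) :
    LEOverModels r r' := by
  intro M N A₀ B₀ m h
  rw [← 𝒜.sub_arrow A₀, ← 𝒜.sub_arrow B₀] at h ⊢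
  generalize A₀.arrow = a at *
  generalize B₀.arrow = b at *
  obtain ⟨U, f, ι, β, hβ, hU⟩ := hr'.exists_long_sequence hAP b m A₀
  obtain ⟨V, g, a', h₁, h₂⟩ := hr.existence U _ _ (a ≫ f) (m ≫ f) ⊤
  obtain ⟨i, hi⟩ := hU V g a'
  rw [push_top] at h₁
  rw [← Category.assoc] at hi
  refine hr'.invariance.of_gtpEq₃ ?_ hi
  exact hr.stationarity _ _ _ _ _ _ _ _ _ _ _ h₂.of_comp_right
    ((hβ i).comp_left hAP g) (hr.mono h₁ le_rfl (𝒜.sub_comp_le _ _)) h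

/-- The union property for directed colimits of models. -/
lemma IsBasic.indep_colimit (hr : r.IsBasic) {J : Type w} [PartialOrder J]
    [IsDirected J (· ≤ ·)] [Nonempty J] {G : J ⥤ 𝒜.Model} {c : Cocone G} (hc : IsColimit c)
    {N : 𝒜.Model} (f : c.pt.obj ⟶ N.obj) {A D : Subobject N.obj}
    (h : ∀ j, r N A (𝒜.sub ((c.ι.app j).hom ≫ f)) D) : r N A (𝒜.sub f) D := by
  have := 𝒜.preservesDirectedColimits J
  let hc' := isColimitOfPreserves 𝒜.isModel.ι hc
  have := hr.union J (G ⋙ 𝒜.isModel.ι) N ((𝒜.isModel.ι.mapCocone c).extend f).ι _ hc' A D h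
  rwa [← hc'.uniq (Cocone.mk N.obj ((𝒜.isModel.ι.mapCocone c).extend f).ι) f fun _ => rfl] at this

/-- If `r` implies the simple independence relation `r'` over models, then the converse holds:
by 3-amalgamation, `A` realizes its type over `B` simultaneously for all members of
a long `r`-independent sequence of copies of `B`. -/
theorem IsSimple.leOverModels (hAP : 𝒜.HasAP) (hr : r.IsBasic) (hr' : r'.IsSimple)
    (hle : LEOverModels r r') : LEOverModels r' r := by
  intro M N A₀ B₀ m h
  rw [← 𝒜.sub_arrow A₀, ← 𝒜.sub_arrow B₀] at h ⊢
  generalize A₀.arrow = a at *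
  generalize B₀.arrow = b at *
  obtain ⟨υ, hυ, hchain⟩ := hr.exists_indep_of_chain (A₀ : C)
  have : Nonempty υ.ord.ToType := by simpa using Cardinal.IsRegular.ne_zero Fact.out
  let := WellFoundedLT.toOrderBot υ.ord.ToType
  have := Cardinal.noMaxOrder (c := υ) (Cardinal.IsRegular.aleph0_le Fact.out)
  let J := υ.ord.ToType
  have := 𝒜.hasIterationOfShape_model J
  obtain ⟨N₀, f₀, a', ha', hg⟩ := hr'.existence N _ _ a m ⊤
  rw [push_top] at ha'
  -- In an arrow of the chain, the source collects the copies of `B` and the target also contains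
  -- the fixed `a'`. The invariant is that `a'` is `r'`-independent from the source over `M`.
  let X₀ : Arrow 𝒜.Model := Arrow.mk (ObjectProperty.homMk f₀ : N ⟶ N₀)
  obtain ⟨P, x, hx, -, hP⟩ := SmallObject.exists_functor_under_of_succ_of_colimit J
    (D := Arrow 𝒜.Model) X₀
    (fun {Y : Arrow 𝒜.Model} (y : X₀ ⟶ Y) =>
      r' Y.right (𝒜.sub (a' ≫ y.right.hom)) (𝒜.sub Y.hom.hom)
        (𝒜.sub (m ≫ y.left.hom ≫ Y.hom.hom)))
    (fun {Y Z : Arrow 𝒜.Model} (y : X₀ ⟶ Y) (f : Y ⟶ Z) => ∃ b' : (B₀ : C) ⟶ Z.left.obj,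
      r Z.left (𝒜.sub b') (𝒜.sub f.left.hom) (𝒜.sub (m ≫ y.left.hom ≫ f.left.hom)) ∧
        𝒜.GtpEq₃ (a' ≫ y.right.hom ≫ f.right.hom) (b' ≫ Z.hom.hom)
          (m ≫ y.left.hom ≫ f.left.hom ≫ Z.hom.hom) a b m)
    (by simpa [X₀] using ha')
    (fun Y y hy => by
      obtain ⟨P', f, b', h₁, h₂⟩ :=
        hr.existence Y.left _ _ (b ≫ y.left.hom) (m ≫ y.left.hom) ⊤
      rw [push_top] at h₁
      have hsq : y.left.hom ≫ Y.hom.hom = f₀ ≫ y.right.hom := congrArg (·.hom) y.w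
      -- The three sides are `A, B` in `N`, `B` and the old source in `P'`, and the old source and
      -- `A` in the old target. The conclusion covers all of `P'`, which restores the invariant.
      obtain ⟨V, f₁, f₂, f₃, ea, eb, ec, em, em', hV⟩ :=
        hr'.threeAmalgamation _ _ _ M N P' Y.right a b m b' f ((m ≫ y.left.hom) ≫ f)
          Y.hom.hom (a' ≫ y.right.hom) (m ≫ y.left.hom ≫ Y.hom.hom) h
          (hle M P' _ _ _ h₁)
          (hr'.symmetry _ _ _ _ hy)
          (by
            have := hg.comp_left hAP y.right.hom
            rw [Category.assoc, ← hsq] at this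
            exact this.symm)
          h₂.of_comp_right.symm
          (by
            obtain ⟨W, k, l, hkl⟩ := hAP Y.left P' Y.right f Y.hom.hom
            exact ⟨W, k, l, hkl, by simp [hkl]⟩)
      rw [ea, em] at hV
      refine ⟨Arrow.mk (ObjectProperty.homMk f₂ : P' ⟶ V),
        Arrow.homMk (ObjectProperty.homMk f) (ObjectProperty.homMk f₃)
          (by ext; exact ec), ⟨b', by simpa using h₁, V, 𝟙 _, f₁, ?_, ?_, ?_⟩, ?_⟩
      · simp [ea]
      · simp [eb]
      · simp [em]
      · simpa using hV)
    (fun j hj G c hc y x hyx hy => by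
      have : Nonempty (Set.Iio j) := ⟨⟨⊥, hj.bot_lt⟩⟩
      have := hasColimitsOfShape_of_isSuccLimit 𝒜.Model j hj
      -- At limits the invariant survives by the union property.
      refine hr'.indep_colimit (isColimitOfPreserves Arrow.leftFunc hc) c.pt.hom.hom fun k => ?_
      have h₁ := (hr'.invariance.comp_iff (c.ι.app k).right.hom).2 (hy k)
      have hsq : (c.ι.app k).left.hom ≫ c.pt.hom.hom =
        (G.obj k).hom.hom ≫ (c.ι.app k).right.hom := congrArg (·.hom) (c.ι.app k).w
      have hr₁ : (y k).right.hom ≫ (c.ι.app k).right.hom = x.right.hom :=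
        congrArg (·.right.hom) (hyx k)
      have hl₁ : (y k).left.hom ≫ (c.ι.app k).left.hom = x.left.hom :=
        congrArg (·.left.hom) (hyx k)
      simp only [Category.assoc, hr₁, ← hsq, reassoc_of% hl₁] at h₁
      exact h₁)
  choose β hβ hβ' using hP
  let U := colimit P
  let s (j : J) : P.obj j ⟶ P.obj (Order.succ j) := P.map (homOfLE (Order.le_succ j))
  let t (j : J) : P.obj j ⟶ U := colimit.ι P j
  have hs (j : J) : s j ≫ t (Order.succ j) = t j := colimit.w P (homOfLE (Order.le_succ j))
  have ht (j : J) : x j ≫ s j ≫ t (Order.succ j) = x ⊥ ≫ t ⊥ := by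
    rw [hs, ← hx ⊥ j (homOfLE bot_le), Category.assoc]
    congr 1
    exact colimit.w P _
  obtain ⟨j, hj⟩ := hchain (P ⋙ Arrow.leftFunc) _
    (isColimitOfPreserves Arrow.leftFunc (colimit.isColimit P)) U.right U.hom.hom
    (a' ≫ (x ⊥ ≫ t ⊥).right.hom)
  change r U.right _ _ (𝒜.sub ((t j).left.hom ≫ U.hom.hom)) at hj
  rw [← ht j, ← hs j] at hj
  have h₁ := hr.indep_of_indep_stage (f := (s j).left.hom)
    (g := (t (Order.succ j)).left.hom ≫ U.hom.hom)
    (by simpa using! hj) (𝒜.sub_comp_le _ _) (d := m ≫ (x j).left.hom) (by simpa using hβ j)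
  have hsq : (t (Order.succ j)).left.hom ≫ U.hom.hom =
    (P.obj (Order.succ j)).hom.hom ≫ (t (Order.succ j)).right.hom :=
      congrArg (·.hom) (t (Order.succ j)).w
  refine hr.invariance.of_gtpEq₃ (hβ' j)
    ((hr.invariance.comp_iff (t (Order.succ j)).right.hom).1 ?_)
  rw [hsq] at h₁
  simpa [s] using h₁

/-! ### From models to arbitrary bases -/

lemma comp_eq_of_gtpEq₂ {M M' : 𝒜.Model} {X Y : C} {e : X ⟶ Y} {k : Y ⟶ M.obj}
    {k' : Y ⟶ M'.obj} {l : X ⟶ M'.obj} (h : 𝒜.GtpEq₂ k' l k (e ≫ k)) : e ≫ k' = l := by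
  obtain ⟨N, f, g, h₁, h₂⟩ := h
  have := 𝒜.mono f
  rw [← cancel_mono f, Category.assoc, h₁, h₂, Category.assoc]

/-- An implication between independence relations over models holds over all bases, as
each base extends to a model that is independent from the given subobjects in both senses. -/
theorem le_of_leOverModels (hAP : 𝒜.HasAP) (hr : r.IsBasic) (hr' : r'.IsBasic)
    (hle : LEOverModels r r') {M : 𝒜.Model} {A B D : Subobject M.obj} (h : r M A B D) :
    r' M A B D := by
  wlog hD : D ≤ B generalizing M A B D
  · obtain ⟨N, f, E, hE, hDE, hBE⟩ := hr.exists_base_le h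
    exact (hr'.invariance.push_iff f).1 (hr'.monotonicity _ _ _ _ _ (this hE hDE) hBE)
  -- The sequence consists of copies of `M` over `D`; each is a model containing `D`, so it can
  -- serve as a new base.
  obtain ⟨U, f, ι, β, hβ, hU⟩ := hr'.exists_long_sequence hAP (𝟙 M.obj) D.arrow M.obj
  obtain ⟨V, g, a', h₁, h₂⟩ := hr.existence U _ _ f (D.arrow ≫ f) ⊤
  obtain ⟨i, hi⟩ := hU V g a'
  have e₁ : D.arrow ≫ a' = (D.arrow ≫ f) ≫ g := comp_eq_of_gtpEq₂ h₂
  have e₂ : D.arrow ≫ β i = D.arrow ≫ f := comp_eq_of_gtpEq₂ (k := 𝟙 M.obj) (by simpa using hβ i)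
  rw [push_top, ← e₁, ← push_eq_sub] at h₁
  rw [← Category.assoc, ← e₁, ← push_eq_sub] at hi
  have hDi : 𝒜.push a' D ≤ 𝒜.sub (β i ≫ g) := by
    rw [push_eq_sub, e₁, ← e₂, Category.assoc]
    exact 𝒜.sub_comp_le _ _
  have h₃ := hr.baseMonotonicity _ _ _ _ _
    (hr.symmetry _ _ _ _ (hr.mono h₁ le_rfl (𝒜.sub_comp_le (β i) g)))
    (𝒜.push_mono a' hD) (𝒜.push_le_sub a' B)
  have h₄ := hr.symmetry _ _ _ _ (hr.mono h₃ le_rfl (𝒜.push_le_sub a' A))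
  -- `E` contains both `B` and the model `β i`, so base-monotonicity can move the base from `D` up
  -- to that model.
  obtain ⟨W, k, E, hE, hBE, hiE⟩ := hr.transitivity _ _ _ _ _
    ((hr.invariance.push_iff a').2 h) h₄ (𝒜.push_mono a' hD)
  have h₅ := hr.baseMonotonicity _ _ _ _ _ hE (𝒜.push_mono k hDi) hiE
  rw [push_sub] at h₅
  have h₆ := hle _ _ _ _ _ h₅
  rw [← push_sub] at h₆
  have h₇ := (hr'.invariance.push_iff k).2 (hr'.mono hi (𝒜.push_le_sub a' A) le_rfl)
  have h₈ := hr'.mono (hr'.trans h₇ h₆ (𝒜.push_mono k hDi)) le_rfl hBE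
  exact (hr'.invariance.push_iff a').1 ((hr'.invariance.push_iff k).1 h₈)

theorem eq_of_leOverModels (hAP : 𝒜.HasAP) (hr : r.IsBasic) (hr' : r'.IsBasic)
    (h : LEOverModels r r') (h' : LEOverModels r' r) : r = r' := by
  funext M A B D
  exact propext ⟨le_of_leOverModels hAP hr hr' h, le_of_leOverModels hAP hr' hr h'⟩

end IndepRel

end AECat

theorem mainTheorem3 {C : Type u} [Category.{v} C] (𝒜 : AECat.{w} C) (hAP : 𝒜.HasAP) :
    (∀ r₁ r₂ : 𝒜.IndepRel, r₁.IsStable → r₂.IsStable → r₁ = r₂) ∧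
    (∀ r₁ r₂ : 𝒜.IndepRel, r₁.IsStable → r₂.IsSimple → r₁ = r₂) := by
  refine ⟨fun r₁ r₂ h₁ h₂ => ?_, fun r₁ r₂ h₁ h₂ => ?_⟩
  · exact AECat.IndepRel.eq_of_leOverModels hAP h₁.toIsBasic h₂.toIsBasic (h₁.leOverModels hAP h₂.toIsBasic)
      (h₂.leOverModels hAP h₁.toIsBasic)
  · have h := h₁.leOverModels hAP h₂.toIsBasic
    exact AECat.IndepRel.eq_of_leOverModels hAP h₁.toIsBasic h₂.toIsBasic h (h₂.leOverModels hAP h₁.toIsBasic h)
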